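/- For positive integers $n_1,n_2$ let $c(n_1,n_2)=\sum_{d_1\mid n_1,\ d_2\mid n_2}\varphi(\gcd(d_1,d_2))$, where $d_1,d_2$ run over the positive divisors of $n_1,n_2$ and $\varphi$ is Euler's totient function. Then, as the real variable $x$ tends to infinity, $$\lim_{x\to\infty}\frac{1}{x^2(\log x)^3}\sum_{1\le n_1,n_2\le x}c(n_1,n_2)=\frac{12}{\pi^4},$$ where the sum runs over all pairs of positive integers $n_1,n_2\le x$. -/

import Mathlib

/-- The two-variable arithmetic function
`c(n₁, n₂) = ∑_{d₁ ∣ n₁, d₂ ∣ n₂} φ(gcd(d₁, d₂))` (for positive `n₁`, `n₂`),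
where `φ` is Euler's totient function. -/
def totientGcdDivisorSum (n₁ n₂ : ℕ) : ℕ :=
  ∑ d₁ ∈ n₁.divisors, ∑ d₂ ∈ n₂.divisors, Nat.totient (Nat.gcd d₁ d₂)

open Finset Filter Topology

/-! Since `φ = μ * id`, also `φ = 1 * (μ * μ * id)`, so `φ(gcd(d₁, d₂))` is the sum of `(μ * μ *
id)(e)` over common divisors `e`. Summing over `n₁, n₂ ≤ N` decouples the two variables and gives `∑
(μ * μ)(a) W(N / a)`, with `W(N) = ∑ b D(N / b)²` and `D` the divisor summatory function
(`sum_totientGcdDivisorSum`).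

From `D(u) = u log u + O(u)` one gets `W(y) / y² = ∑ log²(y / b) / b + O(log² y)`, where the sum
behaves like `∫ log²(y / t) dt / t = log³ y / 3`. Dominated convergence in `a` then gives the limit
`(1 / 3) ∑ (μ * μ)(a) / a² = 1 / (3 ζ(2)²) = 12 / π⁴`. -/

/-- The summatory function `∑_{n ≤ N} τ(n) = ∑_{m ≤ N} ⌊N / m⌋` of the divisor function. -/
def divisorSummatory (N : ℕ) : ℕ := ∑ m ∈ Ioc 0 N, N / m

/-- The sum `∑_{b ≤ N} b D(N / b)²`, where `D` is the summatory function of the divisor function. -/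
def weightedSqDivisorSummatory (N : ℕ) : ℕ := ∑ b ∈ Ioc 0 N, b * divisorSummatory (N / b) ^ 2

/-- The Dirichlet convolution square of the Möbius function. -/
noncomputable def moebiusSq : ArithmeticFunction ℤ :=
  ArithmeticFunction.moebius * ArithmeticFunction.moebius

/-! ### Exact convolution identities -/

theorem sum_Ioc_sum_divisorsAntidiagonal {R : Type*} [AddCommMonoid R] (w : ℕ → ℕ → R) (N : ℕ) :
    ∑ n ∈ Ioc 0 N, ∑ x ∈ n.divisorsAntidiagonal, w x.1 x.2 =
      ∑ a ∈ Ioc 0 N, ∑ b ∈ Ioc 0 (N / a), w a b := by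
  rw [Finset.sum_sigma', Finset.sum_sigma']
  refine Finset.sum_bij' (fun x _ => ⟨x.2.1, x.2.2⟩) (fun x _ => ⟨x.1 * x.2, (x.1, x.2)⟩)
    ?_ ?_ ?_ ?_ ?_
  · rintro ⟨n, a, b⟩ h
    simp only [mem_sigma, mem_Ioc, Nat.mem_divisorsAntidiagonal] at h ⊢
    obtain ⟨⟨h1, h2⟩, rfl, h3⟩ := h
    have ha : 0 < a := Nat.pos_of_ne_zero (left_ne_zero_of_mul h3)
    have hb : 0 < b := Nat.pos_of_ne_zero (right_ne_zero_of_mul h3)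
    refine ⟨⟨ha, (Nat.le_mul_of_pos_right a hb).trans h2⟩, hb, ?_⟩
    rw [Nat.le_div_iff_mul_le ha, mul_comm]
    exact h2
  · rintro ⟨a, b⟩ h
    simp only [mem_sigma, mem_Ioc, Nat.mem_divisorsAntidiagonal] at h ⊢
    obtain ⟨⟨ha, -⟩, hb, h2⟩ := h
    rw [Nat.le_div_iff_mul_le ha, mul_comm] at h2
    have := Nat.mul_pos ha hb
    exact ⟨⟨this, h2⟩, trivial, this.ne'⟩
  · rintro ⟨n, a, b⟩ h
    simp only [mem_sigma, Nat.mem_divisorsAntidiagonal] at h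
    obtain ⟨-, rfl, -⟩ := h
    rfl
  · rintro ⟨a, b⟩ h
    rfl
  · rintro ⟨n, a, b⟩ h
    rfl

theorem sum_Ioc_sum_divisors (f : ℕ → ℤ) (N : ℕ) :
    ∑ n ∈ Ioc 0 N, ∑ d ∈ n.divisors, f d = ∑ d ∈ Ioc 0 N, f d * (N / d : ℕ) := by
  have := sum_Ioc_sum_divisorsAntidiagonal (fun a _ => f a) N
  simp only [sum_const, Nat.card_Ioc, tsub_zero, nsmul_eq_mul] at this
  simp_rw [mul_comm (f _)]
  rw [← this]
  refine sum_congr rfl fun n _ => ?_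
  exact (Nat.sum_divisorsAntidiagonal (fun a _ => f a)).symm

theorem sum_Ioc_filter_dvd {R : Type*} [AddCommMonoid R] (f : ℕ → R) {e : ℕ} (he : 0 < e) (N : ℕ) :
    ∑ d ∈ Ioc 0 N with e ∣ d, f d = ∑ m ∈ Ioc 0 (N / e), f (e * m) := by
  symm
  refine sum_nbij (fun m => e * m) ?_ ?_ ?_ (fun _ _ => rfl)
  · intro m hm
    simp only [mem_Ioc, mem_filter] at hm ⊢
    rw [Nat.le_div_iff_mul_le he, mul_comm] at hm
    exact ⟨⟨Nat.mul_pos he hm.1, hm.2⟩, dvd_mul_right _ _⟩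
  · intro a _ b _ h
    exact Nat.eq_of_mul_eq_mul_left he h
  · intro d hd
    simp only [coe_filter, mem_Ioc, Set.mem_ofPred_eq] at hd
    obtain ⟨⟨h1, h2⟩, m, rfl⟩ := hd
    refine ⟨m, ?_, rfl⟩
    simp only [coe_Ioc, Set.mem_Ioc]
    rw [Nat.le_div_iff_mul_le he, mul_comm]
    exact ⟨pos_of_mul_pos_right h1 (zero_le), h2⟩

/-- Each `d = e m` has `N / (e m)` multiples up to `N`; summing over `m` gives `D(N / e)`. -/
theorem sum_Ioc_card_divisors_dvd {e : ℕ} (he : 0 < e) (N : ℕ) :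
    ∑ n ∈ Ioc 0 N, ∑ d ∈ n.divisors, (if e ∣ d then 1 else 0 : ℤ) = divisorSummatory (N / e) := by
  rw [sum_Ioc_sum_divisors, divisorSummatory]
  simp only [ite_mul, one_mul, zero_mul]
  rw [← sum_filter, sum_Ioc_filter_dvd _ he]
  simp_rw [Nat.cast_sum, Nat.div_div_eq_div_mul]

theorem sum_divisors_moebius_sq_mul_id (n : ℕ) :
    ∑ e ∈ n.divisors, (moebiusSq * (ArithmeticFunction.id : ArithmeticFunction ℤ)) e =
      (n.totient : ℤ) := by
  open ArithmeticFunction in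
  let phi : ArithmeticFunction ℤ := ⟨fun n => (n.totient : ℤ), by simp⟩
  have h1 : (zeta : ArithmeticFunction ℤ) * phi = (ArithmeticFunction.id : ArithmeticFunction ℤ) := by
    ext m
    rw [coe_zeta_mul_apply]
    change ∑ i ∈ m.divisors, (i.totient : ℤ) = _
    rw [← Nat.cast_sum, Nat.sum_totient]
    simp
  have h2 : (zeta : ArithmeticFunction ℤ) *
      (moebiusSq * (ArithmeticFunction.id : ArithmeticFunction ℤ)) = phi := by
    rw [← h1, moebiusSq]
    calc _ = ((zeta : ArithmeticFunction ℤ) * moebius) * ((zeta : ArithmeticFunction ℤ) * moebius) * phi := by ring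
      _ = phi := by simp [coe_zeta_mul_moebius]
  have := congrArg (fun f => f n) h2
  simp only [coe_zeta_mul_apply] at this
  exact this

theorem totient_gcd_eq_sum {N d₁ d₂ : ℕ} (h1 : 0 < d₁) (h : d₁ ≤ N) :
    ((d₁.gcd d₂).totient : ℤ) = ∑ e ∈ Ioc 0 N,
      (moebiusSq * (ArithmeticFunction.id : ArithmeticFunction ℤ)) e *
        ((if e ∣ d₁ then 1 else 0) * (if e ∣ d₂ then 1 else 0)) := by
  have hg : 0 < d₁.gcd d₂ := Nat.gcd_pos_of_pos_left _ h1
  rw [← sum_divisors_moebius_sq_mul_id]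
  have : ∀ e, (moebiusSq * (ArithmeticFunction.id : ArithmeticFunction ℤ)) e *
      ((if e ∣ d₁ then 1 else 0) * (if e ∣ d₂ then 1 else 0)) =
      if e ∣ d₁.gcd d₂ then
        (moebiusSq * (ArithmeticFunction.id : ArithmeticFunction ℤ)) e else 0 := by
    intro e
    by_cases ha : e ∣ d₁ <;> by_cases hb : e ∣ d₂ <;> simp [Nat.dvd_gcd_iff, ha, hb]
  simp only [this]
  rw [← sum_filter]
  refine sum_congr ?_ fun _ _ => rfl
  ext e
  simp only [Nat.mem_divisors, mem_filter, mem_Ioc]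
  constructor
  · rintro ⟨h2, h3⟩
    exact ⟨⟨Nat.pos_of_dvd_of_pos h2 hg,
      (Nat.le_of_dvd h1 (h2.trans (Nat.gcd_dvd_left _ _))).trans h⟩, h2⟩
  · rintro ⟨-, h2⟩
    exact ⟨h2, hg.ne'⟩

theorem sum_totientGcdDivisorSum (N : ℕ) :
    ((∑ n₁ ∈ Ioc 0 N, ∑ n₂ ∈ Ioc 0 N, totientGcdDivisorSum n₁ n₂ : ℕ) : ℤ) =
      ∑ a ∈ Ioc 0 N, moebiusSq a * weightedSqDivisorSummatory (N / a) := by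
  have step : ((∑ n₁ ∈ Ioc 0 N, ∑ n₂ ∈ Ioc 0 N, totientGcdDivisorSum n₁ n₂ : ℕ) : ℤ) =
      ∑ e ∈ Ioc 0 N, (moebiusSq * (ArithmeticFunction.id : ArithmeticFunction ℤ)) e *
        (divisorSummatory (N / e) : ℤ) ^ 2 := by
    have key : ∀ e ∈ Ioc 0 N, (moebiusSq * (ArithmeticFunction.id : ArithmeticFunction ℤ)) e *
        (divisorSummatory (N / e) : ℤ) ^ 2 = ∑ n₁ ∈ Ioc 0 N, ∑ n₂ ∈ Ioc 0 N,
          ∑ d₁ ∈ n₁.divisors, ∑ d₂ ∈ n₂.divisors,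
            (moebiusSq * (ArithmeticFunction.id : ArithmeticFunction ℤ)) e *
        ((if e ∣ d₁ then 1 else 0) * (if e ∣ d₂ then 1 else 0)) := by
      intro e he
      rw [← sum_Ioc_card_divisors_dvd (mem_Ioc.1 he).1, sq]
      simp only [Finset.sum_mul_sum]
      simp only [Finset.mul_sum]
    rw [sum_congr rfl key]
    symm
    push_cast
    refine sum_comm.trans (sum_congr rfl fun n₁ h₁ => ?_)
    refine sum_comm.trans (sum_congr rfl fun n₂ h₂ => ?_)
    rw [totientGcdDivisorSum]
    push_cast
    refine sum_comm.trans (sum_congr rfl fun d₁ hd₁ => ?_)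
    refine sum_comm.trans (sum_congr rfl fun d₂ hd₂ => ?_)
    symm
    exact totient_gcd_eq_sum (Nat.pos_of_mem_divisors hd₁)
      ((Nat.divisor_le hd₁).trans (mem_Ioc.1 h₁).2)
  rw [step]
  -- Unfold the convolution `(μ * μ) * id` at `e = a b`; the inner sum over `b` is `W(N / a)`.
  have := sum_Ioc_sum_divisorsAntidiagonal (fun a b => moebiusSq a * b *
    (divisorSummatory (N / (a * b)) : ℤ) ^ 2) N
  simp only [weightedSqDivisorSummatory, Nat.cast_sum, mul_sum, Nat.div_div_eq_div_mul,
    Nat.cast_mul, Nat.cast_pow, ← mul_assoc]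
  rw [← this]
  refine sum_congr rfl fun n _ => ?_
  rw [ArithmeticFunction.mul_apply, sum_mul]
  refine sum_congr rfl fun x hx => ?_
  rw [(Nat.mem_divisorsAntidiagonal.1 hx).1]
  simp

/-! ### Asymptotics of the weighted sums -/

theorem sum_Ioc_inv_eq_harmonic (N : ℕ) : ∑ m ∈ Ioc 0 N, (m : ℝ)⁻¹ = harmonic N := by
  rw [harmonic_eq_sum_Icc]
  push_cast
  rfl

/-- Compare with `u` times the harmonic sum, which lies between `log u` and `1 + log u`. Dropping
the floors costs at most `⌊u⌋ ≤ u`, and only in the lower bound. -/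
theorem abs_divisorSummatory_sub_le {u : ℝ} (hu : 1 ≤ u) :
    |(divisorSummatory ⌊u⌋₊ : ℝ) - u * Real.log u| ≤ u := by
  have h0 : 0 ≤ u := by linarith
  have hl := log_le_harmonic_floor u h0
  have hr := harmonic_floor_le_one_add_log u hu
  rw [← sum_Ioc_inv_eq_harmonic] at hl hr
  have hD : (divisorSummatory ⌊u⌋₊ : ℝ) = ∑ m ∈ Ioc 0 ⌊u⌋₊, (⌊u / m⌋₊ : ℝ) := by
    simp [divisorSummatory, Nat.floor_div_natCast]
  have hup : (divisorSummatory ⌊u⌋₊ : ℝ) ≤ u * ∑ m ∈ Ioc 0 ⌊u⌋₊, (m : ℝ)⁻¹ := by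
    rw [hD, mul_sum]
    refine sum_le_sum fun m _ => ?_
    rw [← div_eq_mul_inv]
    exact Nat.floor_le (by positivity)
  have hlo : u * ∑ m ∈ Ioc 0 ⌊u⌋₊, (m : ℝ)⁻¹ - ⌊u⌋₊ ≤ (divisorSummatory ⌊u⌋₊ : ℝ) := by
    have : (⌊u⌋₊ : ℝ) = ∑ m ∈ Ioc 0 ⌊u⌋₊, (1 : ℝ) := by simp
    rw [hD, mul_sum]
    rw [this]
    rw [← sum_sub_distrib]
    refine sum_le_sum fun m _ => ?_
    rw [← div_eq_mul_inv]
    exact (Nat.sub_one_lt_floor _).le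
  have hf := Nat.floor_le h0
  have h1 := mul_le_mul_of_nonneg_left hl h0
  have h2 := mul_le_mul_of_nonneg_left hr h0
  rw [abs_le]
  constructor <;> linarith

theorem cube_sub_cube_bounds {s t δ₁ δ₂ : ℝ} (ht : 0 ≤ t) (h : t ≤ s) (h₁ : δ₁ ≤ s - t)
    (h₂ : s - t ≤ δ₂) :
    δ₁ * t ^ 2 ≤ (s ^ 3 - t ^ 3) / 3 ∧ (s ^ 3 - t ^ 3) / 3 ≤ δ₂ * s ^ 2 := by
  constructor
  · calc δ₁ * t ^ 2 ≤ (s - t) * t ^ 2 := by gcongr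
      _ ≤ _ := by nlinarith [mul_nonneg (sub_nonneg.2 h) (mul_nonneg ht (sub_nonneg.2 h)), mul_nonneg (sub_nonneg.2 h) (sq_nonneg (s - t))]
  · calc (s ^ 3 - t ^ 3) / 3 ≤ (s - t) * s ^ 2 := by
          nlinarith [mul_nonneg (sub_nonneg.2 h) (mul_nonneg ht (sub_nonneg.2 h)), mul_nonneg (sub_nonneg.2 h) (sq_nonneg (s - t))]
      _ ≤ _ := by gcongr

theorem inv_add_one_le_log_div_sub {y : ℝ} (hy : 0 < y) {b : ℕ} (hb : 0 < b) :
    ((b + 1 : ℕ) : ℝ)⁻¹ ≤ Real.log (y / b) - Real.log (y / (b + 1 : ℕ)) ∧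
      Real.log (y / b) - Real.log (y / (b + 1 : ℕ)) ≤ (b : ℝ)⁻¹ := by
  have hb' : (0 : ℝ) < b := by exact_mod_cast hb
  have e : Real.log (y / b) - Real.log (y / (b + 1 : ℕ)) = Real.log ((b + 1) / b) := by
    push_cast
    rw [Real.log_div hy.ne' hb'.ne', Real.log_div hy.ne' (by positivity),
      Real.log_div (by positivity) hb'.ne']
    ring
  rw [e]
  constructor
  · have := Real.one_sub_inv_le_log_of_pos (x := ((b : ℝ) + 1) / b) (by positivity)
    refine le_trans (le_of_eq ?_) this
    push_cast
    field_simp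
    ring
  · have := Real.log_le_sub_one_of_pos (x := ((b : ℝ) + 1) / b) (by positivity)
    refine this.trans (le_of_eq ?_)
    field_simp
    ring

/-- A telescoping form of the integral comparison, with `-log³(y / t) / 3` as antiderivative of
`log²(y / t) / t`. -/
theorem sum_inv_mul_log_sq_bounds {y : ℝ} (N : ℕ) (hN : ((N + 1 : ℕ) : ℝ) ≤ y) :
    (Real.log y ^ 3 - Real.log (y / (N + 1 : ℕ)) ^ 3) / 3 ≤
        ∑ b ∈ Ioc 0 (N + 1), (b : ℝ)⁻¹ * Real.log (y / b) ^ 2 ∧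
      ∑ b ∈ Ioc 0 (N + 1), (b : ℝ)⁻¹ * Real.log (y / b) ^ 2 ≤ Real.log y ^ 2 +
        (Real.log y ^ 3 - Real.log (y / (N + 1 : ℕ)) ^ 3) / 3 := by
  -- The lower bound must carry the last term: the cube increment from `b` to `b + 1` is bounded
  -- above by the term at `b`, not at `b + 1`.
  suffices H : (Real.log y ^ 3 - Real.log (y / (N + 1 : ℕ)) ^ 3) / 3 +
        ((N + 1 : ℕ) : ℝ)⁻¹ * Real.log (y / (N + 1 : ℕ)) ^ 2 ≤
        ∑ b ∈ Ioc 0 (N + 1), (b : ℝ)⁻¹ * Real.log (y / b) ^ 2 ∧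
      ∑ b ∈ Ioc 0 (N + 1), (b : ℝ)⁻¹ * Real.log (y / b) ^ 2 ≤ Real.log y ^ 2 +
        (Real.log y ^ 3 - Real.log (y / (N + 1 : ℕ)) ^ 3) / 3 by
    refine ⟨le_trans (le_add_of_nonneg_right ?_) H.1, H.2⟩
    positivity
  induction N with
  | zero => simp
  | succ N ih =>
    have hN' : ((N + 1 : ℕ) : ℝ) ≤ y := le_trans (by push_cast; linarith) hN
    have hy : 0 < y := lt_of_lt_of_le (by positivity) hN'
    obtain ⟨i1, i2⟩ := ih hN'
    rw [sum_Ioc_succ_top (Nat.zero_le _)]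
    obtain ⟨l1, l2⟩ := inv_add_one_le_log_div_sub hy (Nat.succ_pos N)
    have ht : 0 ≤ Real.log (y / (N + 1 + 1 : ℕ)) :=
      Real.log_nonneg (by rwa [le_div_iff₀ (by positivity), one_mul])
    have hst : Real.log (y / (N + 1 + 1 : ℕ)) ≤ Real.log (y / (N + 1 : ℕ)) :=
      sub_nonneg.1 (le_trans (by positivity) l1)
    obtain ⟨c1, c2⟩ := cube_sub_cube_bounds ht hst l1 l2
    constructor <;> linarith

theorem abs_sum_inv_mul_log_sq_sub_le {y : ℝ} (hy : 1 ≤ y) :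
    |∑ b ∈ Ioc 0 ⌊y⌋₊, (b : ℝ)⁻¹ * Real.log (y / b) ^ 2 - Real.log y ^ 3 / 3| ≤
      1 + Real.log y ^ 2 := by
  have hf : 0 < ⌊y⌋₊ := Nat.floor_pos.2 hy
  obtain ⟨N, hN⟩ := Nat.exists_eq_add_of_lt hf
  rw [zero_add] at hN
  have hle : ((N + 1 : ℕ) : ℝ) ≤ y := hN ▸ Nat.floor_le (by linarith)
  have hlt : y < (N + 1 : ℕ) + 1 := hN ▸ Nat.lt_floor_add_one y
  have hp : (1 : ℝ) ≤ (N + 1 : ℕ) := by exact_mod_cast Nat.succ_pos N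
  obtain ⟨h1, h2⟩ := sum_inv_mul_log_sq_bounds N hle
  rw [← hN] at h1 h2 hle hlt hp
  have q1 : 0 ≤ Real.log (y / ⌊y⌋₊) :=
    Real.log_nonneg (by rwa [le_div_iff₀ (by positivity), one_mul])
  -- Here `y < ⌊y⌋ + 1 ≤ 2 ⌊y⌋`, so the leftover cube lies in `[0, 1]`.
  have q2 : Real.log (y / ⌊y⌋₊) ≤ 1 := by
    have := Real.log_le_sub_one_of_pos (x := y / ⌊y⌋₊) (by positivity)
    have : y / ⌊y⌋₊ ≤ 2 := by
      rw [div_le_iff₀ (by positivity)]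
      linarith
    linarith
  have q3 : Real.log (y / ⌊y⌋₊) ^ 3 ≤ 1 := pow_le_one₀ q1 q2
  have q4 : 0 ≤ Real.log (y / ⌊y⌋₊) ^ 3 := pow_nonneg q1 3
  have q5 := sq_nonneg (Real.log y)
  rw [abs_le]
  constructor <;> linarith

theorem abs_weightedSqDivisorSummatory_div_sub_le {y : ℝ} (hy : 1 ≤ y) :
    |(weightedSqDivisorSummatory ⌊y⌋₊ : ℝ) / y ^ 2 - Real.log y ^ 3 / 3| ≤
      3 * (1 + Real.log y) ^ 2 := by
  have hy0 : 0 < y := by linarith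
  have hL : 0 ≤ Real.log y := Real.log_nonneg hy
  have hrep : (weightedSqDivisorSummatory ⌊y⌋₊ : ℝ) / y ^ 2 = ∑ b ∈ Ioc 0 ⌊y⌋₊,
      (b : ℝ)⁻¹ * ((divisorSummatory ⌊y / b⌋₊ : ℝ) / (y / b)) ^ 2 := by
    rw [weightedSqDivisorSummatory]
    push_cast
    rw [sum_div]
    refine sum_congr rfl fun b hb => ?_
    have : (b : ℝ) ≠ 0 := by exact_mod_cast (mem_Ioc.1 hb).1.ne'
    rw [Nat.floor_div_natCast]
    field_simp
  have hdiff : |(weightedSqDivisorSummatory ⌊y⌋₊ : ℝ) / y ^ 2 -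
      ∑ b ∈ Ioc 0 ⌊y⌋₊, (b : ℝ)⁻¹ * Real.log (y / b) ^ 2| ≤
      -- With `F = D(u) / u`, `l = log u` and `|F - l| ≤ 1`, one has `|F² - l²| ≤ 1 + 2 l`; the
      -- other factor bounds the harmonic sum.
      (1 + 2 * Real.log y) * (1 + Real.log y) := by
    have hr := harmonic_floor_le_one_add_log y hy
    rw [← sum_Ioc_inv_eq_harmonic] at hr
    rw [hrep, ← sum_sub_distrib]
    refine (abs_sum_le_sum_abs _ _).trans ?_
    refine le_trans ?_ (mul_le_mul_of_nonneg_left hr (by positivity))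
    rw [mul_sum]
    refine sum_le_sum fun b hb => ?_
    obtain ⟨hb0, hb1⟩ := mem_Ioc.1 hb
    have hb0' : (1 : ℝ) ≤ b := by exact_mod_cast hb0
    have hby : (b : ℝ) ≤ y := (Nat.le_floor_iff hy0.le).1 hb1
    have hu : 1 ≤ y / b := by rwa [le_div_iff₀ (by positivity), one_mul]
    have hu0 : 0 < y / b := by linarith
    have hl0 : 0 ≤ Real.log (y / b) := Real.log_nonneg hu
    have hl1 : Real.log (y / b) ≤ Real.log y :=
      Real.log_le_log hu0 (div_le_self hy0.le hb0')
    have hd := abs_divisorSummatory_sub_le hu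
    have hF : |(divisorSummatory ⌊y / b⌋₊ : ℝ) / (y / b) - Real.log (y / b)| ≤ 1 := by
      have : (divisorSummatory ⌊y / b⌋₊ : ℝ) / (y / b) - Real.log (y / b) =
          ((divisorSummatory ⌊y / b⌋₊ : ℝ) - y / b * Real.log (y / b)) / (y / b) := by
        rw [sub_div, mul_div_cancel_left₀ _ hu0.ne']
      rw [this, abs_div, abs_of_pos hu0, div_le_one hu0]
      exact hd
    rw [← mul_sub, abs_mul, abs_of_nonneg (by positivity : (0 : ℝ) ≤ (b : ℝ)⁻¹), mul_comm]
    refine mul_le_mul_of_nonneg_right ?_ (by positivity)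
    generalize (divisorSummatory ⌊y / b⌋₊ : ℝ) / (y / b) = F at hF
    generalize Real.log (y / b) = l at *
    obtain ⟨f1, f2⟩ := abs_le.1 hF
    rw [abs_le]
    constructor <;> nlinarith
  have h3 := abs_sum_inv_mul_log_sq_sub_le hy
  have := abs_sub_le ((weightedSqDivisorSummatory ⌊y⌋₊ : ℝ) / y ^ 2)
    (∑ b ∈ Ioc 0 ⌊y⌋₊, (b : ℝ)⁻¹ * Real.log (y / b) ^ 2) (Real.log y ^ 3 / 3)
  nlinarith

theorem tendsto_weightedSqDivisorSummatory :
    Tendsto (fun y : ℝ => (weightedSqDivisorSummatory ⌊y⌋₊ : ℝ) / y ^ 2 / Real.log y ^ 3)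
      atTop (𝓝 (1 / 3)) := by
  rw [tendsto_iff_norm_sub_tendsto_zero]
  -- For `log y ≥ 1`, `3 (1 + log y)² ≤ 12 log² y`.
  have hlim : Tendsto (fun y : ℝ => 12 * (Real.log y)⁻¹) atTop (𝓝 0) := by
    simpa using (tendsto_inv_atTop_zero.comp Real.tendsto_log_atTop).const_mul (12 : ℝ)
  refine squeeze_zero' (Eventually.of_forall fun _ => norm_nonneg _) ?_ hlim
  filter_upwards [eventually_ge_atTop 1, Real.tendsto_log_atTop.eventually_ge_atTop 1]
    with y hy hl
  have hl0 : 0 < Real.log y := by linarith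
  have h := abs_weightedSqDivisorSummatory_div_sub_le hy
  have e : (weightedSqDivisorSummatory ⌊y⌋₊ : ℝ) / y ^ 2 / Real.log y ^ 3 - 1 / 3 =
      ((weightedSqDivisorSummatory ⌊y⌋₊ : ℝ) / y ^ 2 - Real.log y ^ 3 / 3) / Real.log y ^ 3 := by
    rw [sub_div]
    congr 1
    field_simp
  rw [e, Real.norm_eq_abs, abs_div, abs_of_pos (pow_pos hl0 3), div_le_iff₀ (pow_pos hl0 3)]
  have : 12 * (Real.log y)⁻¹ * Real.log y ^ 3 = 12 * Real.log y ^ 2 := by field_simp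
  rw [this]
  nlinarith

theorem tendsto_log_div_const_div_log {a : ℝ} (ha : 0 < a) :
    Tendsto (fun x : ℝ => Real.log (x / a) / Real.log x) atTop (𝓝 1) := by
  have h : Tendsto (fun x : ℝ => 1 - Real.log a * (Real.log x)⁻¹) atTop (𝓝 1) := by
    simpa using ((tendsto_inv_atTop_zero.comp Real.tendsto_log_atTop).const_mul
      (Real.log a)).const_sub 1
  refine h.congr' ?_
  filter_upwards [eventually_gt_atTop 1] with x hx
  have := Real.log_pos hx
  rw [Real.log_div (by positivity) ha.ne', sub_div, div_self this.ne', div_eq_mul_inv]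

theorem tendsto_weightedSqDivisorSummatory_div {a : ℝ} (ha : 0 < a) :
    Tendsto (fun x : ℝ => (weightedSqDivisorSummatory ⌊x / a⌋₊ : ℝ) / (x / a) ^ 2 / Real.log x ^ 3)
      atTop (𝓝 (1 / 3)) := by
  have hx : Tendsto (fun x : ℝ => x / a) atTop atTop := tendsto_id.atTop_div_const ha
  have h := (tendsto_weightedSqDivisorSummatory.comp hx).mul
    ((tendsto_log_div_const_div_log ha).pow 3)
  rw [one_pow, mul_one] at h
  refine h.congr' ?_
  filter_upwards [hx.eventually_gt_atTop 1] with x hx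
  have := Real.log_pos hx
  simp only [Function.comp_apply]
  field_simp

/-- The bound, uniform in `a`, needed for domination: `1 / 3 + 12 ≤ 13`, while `W` vanishes for `a >
x`. -/
theorem weightedSqDivisorSummatory_div_le {x : ℝ} (hx : 1 ≤ Real.log x) (hx1 : 1 ≤ x) {a : ℕ}
    (ha : 0 < a) :
    (weightedSqDivisorSummatory ⌊x / a⌋₊ : ℝ) / (x / a) ^ 2 / Real.log x ^ 3 ≤ 13 := by
  have hL : 0 < Real.log x := by linarith
  have ha1 : (1 : ℝ) ≤ a := by exact_mod_cast ha
  rcases lt_or_ge (x / a) 1 with h | h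
  · rw [Nat.floor_eq_zero.2 h]
    simp [weightedSqDivisorSummatory]
  · have hl0 : 0 ≤ Real.log (x / a) := Real.log_nonneg h
    have hl1 : Real.log (x / a) ≤ Real.log x :=
      Real.log_le_log (by linarith) (div_le_self (by linarith) ha1)
    have hb := (abs_le.1 (abs_weightedSqDivisorSummatory_div_sub_le h)).2
    rw [div_le_iff₀ (pow_pos hL 3)]
    have h1 : Real.log (x / a) ^ 3 ≤ Real.log x ^ 3 := pow_le_pow_left₀ hl0 hl1 3
    have h2 : (1 + Real.log (x / a)) ^ 2 ≤ (2 * Real.log x) ^ 2 :=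
      pow_le_pow_left₀ (by linarith) (by linarith) 2
    have h3 : Real.log x ^ 2 ≤ Real.log x ^ 3 := pow_le_pow_right₀ hx (by norm_num)
    have h4 : 0 ≤ Real.log x ^ 3 := by positivity
    nlinarith

/-! ### The constant and the passage to the limit -/

/-- The Dirichlet series of `μ * μ` at `2` is `ζ(2)⁻²`, with `ζ(2) = π² / 6`. -/
theorem hasSum_moebiusSq_div_sq :
    HasSum (fun a : ℕ => (moebiusSq a : ℝ) / (a : ℝ) ^ 2) (36 / Real.pi ^ 4) := by
  have hs : (1 : ℝ) < (2 : ℂ).re := by norm_num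
  have hm := (ArithmeticFunction.LSeriesSummable_moebius_iff.mpr hs).LSeriesHasSum
  have hz := ArithmeticFunction.LSeries_zeta_mul_Lseries_moebius hs
  rw [ArithmeticFunction.LSeries_zeta_eq_riemannZeta hs, riemannZeta_two] at hz
  have hpi : (Real.pi : ℂ) ≠ 0 := by exact_mod_cast Real.pi_ne_zero
  have hval : LSeries (fun n => ((ArithmeticFunction.moebius n : ℤ) : ℂ)) 2 = 6 / (Real.pi : ℂ) ^ 2 := by
    rw [eq_div_iff (pow_ne_zero 2 hpi)]
    linear_combination 6 * hz
  rw [hval] at hm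
  have hc := ArithmeticFunction.LSeriesHasSum_mul
    (f := (ArithmeticFunction.moebius : ArithmeticFunction ℂ))
    (g := (ArithmeticFunction.moebius : ArithmeticFunction ℂ)) hm hm
  have hh : ((ArithmeticFunction.moebius : ArithmeticFunction ℂ) *
      (ArithmeticFunction.moebius : ArithmeticFunction ℂ)) = (moebiusSq : ArithmeticFunction ℂ) := by
    rw [moebiusSq, ArithmeticFunction.intCoe_mul]
  rw [hh, LSeriesHasSum] at hc
  rw [← Complex.hasSum_ofReal]
  convert hc using 1
  · ext n
    rcases eq_or_ne n 0 with rfl | hn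
    · simp
    · rw [LSeries.term_of_ne_zero hn]
      simp
  · push_cast
    field_simp
    norm_num

/-- Terms with `a > x` vanish because `W(0) = 0`, so the index set no longer depends on `x`, as
dominated convergence requires. -/
theorem sum_totientGcdDivisorSum_div_eq_tsum {x : ℝ} (hx : 0 < x) :
    (∑ n₁ ∈ Icc 1 ⌊x⌋₊, ∑ n₂ ∈ Icc 1 ⌊x⌋₊, (totientGcdDivisorSum n₁ n₂ : ℝ)) /
        (x ^ 2 * Real.log x ^ 3) =
      ∑' a : ℕ, (moebiusSq a : ℝ) / (a : ℝ) ^ 2 *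
        ((weightedSqDivisorSummatory ⌊x / a⌋₊ : ℝ) / (x / a) ^ 2 / Real.log x ^ 3) := by
  have h := congrArg (Int.cast : ℤ → ℝ) (sum_totientGcdDivisorSum ⌊x⌋₊)
  push_cast at h
  have hI : Icc 1 ⌊x⌋₊ = Ioc 0 ⌊x⌋₊ := rfl
  rw [hI, h, sum_div, tsum_eq_sum (s := Ioc 0 ⌊x⌋₊)]
  · refine sum_congr rfl fun a ha => ?_
    have : (a : ℝ) ≠ 0 := by exact_mod_cast (mem_Ioc.1 ha).1.ne'
    rw [Nat.floor_div_natCast]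
    field_simp
  · intro a ha
    rcases Nat.eq_zero_or_pos a with rfl | h0
    · simp
    · have h1 : ⌊x⌋₊ < a := by
        by_contra hcon
        exact ha (mem_Ioc.2 ⟨h0, not_lt.1 hcon⟩)
      rw [Nat.floor_div_natCast, Nat.div_eq_of_lt h1]
      simp [weightedSqDivisorSummatory]

theorem mainTheorem6 :
    Filter.Tendsto
      (fun x : ℝ =>
        (∑ n₁ ∈ Finset.Icc 1 ⌊x⌋₊, ∑ n₂ ∈ Finset.Icc 1 ⌊x⌋₊,
            (totientGcdDivisorSum n₁ n₂ : ℝ)) /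
          (x ^ 2 * (Real.log x) ^ 3))
      Filter.atTop (nhds (12 / Real.pi ^ 4)) := by
  have hsum := hasSum_moebiusSq_div_sq
  have hlim : Tendsto (fun x : ℝ => ∑' a : ℕ, (moebiusSq a : ℝ) / (a : ℝ) ^ 2 *
      ((weightedSqDivisorSummatory ⌊x / a⌋₊ : ℝ) / (x / a) ^ 2 / Real.log x ^ 3)) atTop
      (𝓝 (∑' a : ℕ, (moebiusSq a : ℝ) / (a : ℝ) ^ 2 * (1 / 3))) := by
    refine tendsto_tsum_of_dominated_convergence
      (bound := fun a : ℕ => ‖(moebiusSq a : ℝ) / (a : ℝ) ^ 2‖ * 13)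
      (hsum.summable.norm.mul_right 13) ?_ ?_
    · intro a
      rcases Nat.eq_zero_or_pos a with rfl | ha
      · simp
      · exact (tendsto_weightedSqDivisorSummatory_div (by exact_mod_cast ha)).const_mul _
    · filter_upwards [eventually_ge_atTop 1, Real.tendsto_log_atTop.eventually_ge_atTop 1]
        with x hx hl a
      rcases Nat.eq_zero_or_pos a with rfl | ha
      · simp
      · rw [norm_mul]
        refine mul_le_mul_of_nonneg_left ?_ (norm_nonneg _)
        rw [Real.norm_of_nonneg (by positivity)]
        exact weightedSqDivisorSummatory_div_le hl hx ha
  rw [(hsum.mul_right (1 / 3)).tsum_eq] at hlim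
  have hval : 36 / Real.pi ^ 4 * (1 / 3) = 12 / Real.pi ^ 4 := by ring
  rw [hval] at hlim
  refine hlim.congr' ?_
  filter_upwards [eventually_gt_atTop 0] with x hx
  exact (sum_totientGcdDivisorSum_div_eq_tsum hx).symm
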